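/- For a real random variable $Y$ and $\alpha>0$ let $\|Y\|_{\psi_\alpha}:=\inf\{\eta>0:\ \mathbb{E}[\exp((|Y|/\eta)^\alpha)-1]\le 1\}$ (with $\inf\emptyset=\infty$), and for a random vector $Y\in\mathbb{R}^p$ let $\|Y\|_{M,\psi_\alpha}:=\max_{1\le j\le p}\|Y(j)\|_{\psi_\alpha}$, where $Y(j)$ is the $j$-th coordinate. **Theorem.** For every $0<\alpha\le 2$ there is a constant $C_\alpha>0$, depending only on $\alpha$, such that the following holds. Let $n,p\ge 1$, let $X_1,\dots,X_n$ be independent (not necessarily identically distributed or centered) random vectors in $\mathbb{R}^p$, and let $K_{n,p}<\infty$ satisfy $$\max_{1\le i\le n}\|X_i\|_{M,\psi_\alpha}\le K_{n,p}.$$ Put $\bar X_n:=\frac1n\sum_{i=1}^n X_i$, $\bar\mu_n:=\mathbb{E}[\bar X_n]$, $$\hat\Sigma_n^*:=\frac1n\sum_{i=1}^n (X_i-\bar X_n)(X_i-\bar X_n)^\top,\qquad \Sigma_n^*:=\frac1n\sum_{i=1}^n\mathbb{E}\big[(X_i-\bar\mu_n)(X_i-\bar\mu_n)^\top\big],$$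 $$\Delta_n^*:=\max_{1\le j,k\le p}\big|\hat\Sigma_n^*(j,k)-\Sigma_n^*(j,k)\big|,$$ $$A_{n,p}^*:=\max_{1\le j\le k\le p}\Big(\frac1n\sum_{i=1}^n\mathrm{Var}\big((X_i(j)-\bar\mu_n(j))(X_i(k)-\bar\mu_n(k))\big)\Big)^{1/2}.$$ Then for every $t\ge 0$, with probability at least $1-6e^{-t}$, $$\Delta_n^*\le 7A_{n,p}^*\sqrt{\frac{t+2\log p}{n}}+\frac{C_\alpha K_{n,p}^2(\log(2n))^{2/\alpha}(t+2\log p)^{2/\alpha}}{n}.$$ -/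

import Mathlib

open MeasureTheory ProbabilityTheory
open scoped ENNReal NNReal

noncomputable section

namespace SubWeibull

/-- The `g`-Orlicz norm `inf {η > 0 : E[g(|X|/η)] ≤ 1}` of a real random variable, with values in
`[0, ∞]` (it is `∞` when no `η` is admissible). -/
def orliczNorm {Ω : Type*} [MeasurableSpace Ω] (P : Measure Ω) (g : ℝ → ℝ) (X : Ω → ℝ) : ℝ≥0∞ :=
  ⨅ (η : ℝ) (_ : 0 < η) (_ : ∫⁻ ω, ENNReal.ofReal (g (|X ω| / η)) ∂P ≤ 1), ENNReal.ofReal η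

/-- `ψ_α(x) = exp(x^α) - 1` for `x ≥ 0`. -/
def psi (α : ℝ) (x : ℝ) : ℝ := Real.exp (x ^ α) - 1

/-- The marginal sub-Weibull norm: the largest `ψ_α`-norm of a coordinate. -/
def marginalNorm {Ω : Type*} [MeasurableSpace Ω] (P : Measure Ω) (α : ℝ) {p : ℕ}
    (X : Ω → Fin p → ℝ) : ℝ≥0∞ :=
  ⨆ j : Fin p, orliczNorm P (psi α) (fun ω => X ω j)

/-- The elementwise maximum norm of a matrix. -/
def maxNorm {p : ℕ} (M : Matrix (Fin p) (Fin p) ℝ) : ℝ :=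
  ⨆ jk : Fin p × Fin p, |M jk.1 jk.2|

/-- The sample mean `X̄_n`. -/
def sampleMean {Ω : Type*} {n p : ℕ} (X : Fin n → Ω → Fin p → ℝ) (ω : Ω) : Fin p → ℝ :=
  (n : ℝ)⁻¹ • ∑ i, X i ω

/-- The averaged mean `μ̄_n = E[X̄_n]`, coordinate by coordinate. -/
def meanVec {Ω : Type*} [MeasurableSpace Ω] (P : Measure Ω) {n p : ℕ}
    (X : Fin n → Ω → Fin p → ℝ) : Fin p → ℝ :=
  fun j => ∫ ω, sampleMean X ω j ∂P

/-- The sample covariance matrix `(1/n) ∑ (X_i - X̄_n)(X_i - X̄_n)ᵀ`. -/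
def sampleCov {Ω : Type*} {n p : ℕ} (X : Fin n → Ω → Fin p → ℝ) (ω : Ω) :
    Matrix (Fin p) (Fin p) ℝ :=
  (n : ℝ)⁻¹ • ∑ i, Matrix.vecMulVec (X i ω - sampleMean X ω) (X i ω - sampleMean X ω)

/-- The population matrix `(1/n) ∑ E[(X_i - μ̄_n)(X_i - μ̄_n)ᵀ]`, expectations entry by entry. -/
def popCov {Ω : Type*} [MeasurableSpace Ω] (P : Measure Ω) {n p : ℕ}
    (X : Fin n → Ω → Fin p → ℝ) : Matrix (Fin p) (Fin p) ℝ :=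
  (n : ℝ)⁻¹ • ∑ i, Matrix.of fun j k =>
    ∫ ω, Matrix.vecMulVec (X i ω - meanVec P X) (X i ω - meanVec P X) j k ∂P

/-- `Δ_n^*`, the elementwise maximum norm error of the sample covariance matrix. -/
def covError {Ω : Type*} [MeasurableSpace Ω] (P : Measure Ω) {n p : ℕ}
    (X : Fin n → Ω → Fin p → ℝ) (ω : Ω) : ℝ :=
  maxNorm (sampleCov X ω - popCov P X)

/-- `A_{n,p}^*`, the maximum over `j ≤ k` of
`((1/n) ∑ Var((X_i(j) - μ̄_n(j)) (X_i(k) - μ̄_n(k))))^{1/2}`. -/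
def maxStdDev {Ω : Type*} [MeasurableSpace Ω] (P : Measure Ω) {n p : ℕ}
    (X : Fin n → Ω → Fin p → ℝ) : ℝ :=
  ⨆ jk : {jk : Fin p × Fin p // jk.1 ≤ jk.2},
    Real.sqrt ((n : ℝ)⁻¹ * ∑ i, variance
      (fun ω => (X i ω jk.1.1 - meanVec P X jk.1.1) * (X i ω jk.1.2 - meanVec P X jk.1.2)) P)

end SubWeibull

end

/-! Expanding about the averaged mean splits each entry of the error into two pieces: the average of
the products (X_i(j) - μ̄(j))(X_i(k) - μ̄(k)) minus their expectations, and the product of the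
deviations of two coordinate means (`sampleCov_sub_popCov_apply`). The products have exponential
moments of order α/2 ≤ 1, so their sum is needed with its exact variance in the leading term
(`deviation_variance`). The sums behind the coordinate means are only needed up to √n times
logarithms and powers of s (`deviation_sqrt`), since multiplying two of them and dividing by n²
already gives order 1/n.

Both deviation bounds come from one truncation at r = (2 log(2n))^{1/β}, for which exp(-r^β/2) =
1/(2n). The truncated sum obeys Bernstein's inequality, with a total bias bounded independently of
n. For the removed part, the variables |W_i|^β 1{|W_i| > r} satisfy E exp(·/2) ≤ 1 + B/(2n), so by
Chernoff their sum exceeds 2s + B with probability at most e^{-s}. The power 1/β is then taken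
outside the sum: at no cost if β ≤ 1, and at the cost of √n if β ≤ 2.

A union bound over p² pairs and p coordinates with s = t + 2 log p finishes the proof
(`covError_tail`). -/

/-! ### Chernoff and Bernstein bounds without centering -/

noncomputable section

namespace SubWeibull

variable {Ω : Type*} [MeasurableSpace Ω] {P : Measure Ω} [IsProbabilityMeasure P]

/-- Chernoff's bound for a sum of independent variables. -/
lemma measureReal_le_sum_le_exp {n : ℕ} {T : Fin n → Ω → ℝ} (hm : ∀ i, Measurable (T i))
    (hind : iIndepFun T P) {l : ℝ} (hl : 0 ≤ l)
    (hint : ∀ i, Integrable (fun ω => Real.exp (l * T i ω)) P) {b : Fin n → ℝ}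
    (hb : ∀ i, ∫ ω, Real.exp (l * T i ω) ∂P ≤ Real.exp (b i)) (x : ℝ) :
    P.real {ω | x ≤ ∑ i, T i ω} ≤ Real.exp (-l * x + ∑ i, b i) := by
  have hs : (fun ω => ∑ i, T i ω) = ∑ i, T i := by ext ω; simp
  have h1 := measure_ge_le_exp_mul_mgf (μ := P) (X := ∑ i, T i) x hl
    (hind.integrable_exp_mul_sum hm (fun i _ => hint i))
  rw [← hs] at h1
  refine h1.trans ?_
  rw [hs, hind.mgf_sum hm, Real.exp_add, Real.exp_sum]
  gcongr with i
  · intro i _; exact mgf_nonneg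
  · exact hb i

lemma integrable_of_abs_le {f : Ω → ℝ} (hf : Measurable f) {c : ℝ} (h : ∀ ω, |f ω| ≤ c) :
    Integrable f P :=
  Integrable.of_bound hf.aestronglyMeasurable c (Filter.Eventually.of_forall h)

/-- Integrates e^x ≤ 1 + x + x² for |x| ≤ 1. The mean stays in the exponent because truncation
destroys centering. -/
lemma integral_exp_mul_le {T : Ω → ℝ} (hT : Measurable T) {r l : ℝ} (hl : 0 ≤ l)
    (hb : ∀ ω, |T ω| ≤ r) (hlr : l * r ≤ 1) :
    Integrable (fun ω => Real.exp (l * T ω)) P ∧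
    ∫ ω, Real.exp (l * T ω) ∂P ≤ Real.exp (l * |∫ ω, T ω ∂P| + l ^ 2 * ∫ ω, T ω ^ 2 ∂P) := by
  have hlT : ∀ ω, |l * T ω| ≤ 1 := fun ω => by
    rw [abs_mul, abs_of_nonneg hl]
    exact (mul_le_mul_of_nonneg_left (hb ω) hl).trans hlr
  have i1 : Integrable T P := integrable_of_abs_le hT hb
  have i2 : Integrable (fun ω => T ω ^ 2) P :=
    integrable_of_abs_le (hT.pow_const 2) (c := r ^ 2) fun ω => by
      rw [abs_pow]; exact pow_le_pow_left₀ (abs_nonneg _) (hb ω) 2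
  have i3 : Integrable (fun ω => Real.exp (l * T ω)) P :=
    integrable_of_abs_le (hT.const_mul l).exp (c := Real.exp 1) fun ω => by
      rw [abs_of_pos (Real.exp_pos _)]
      exact Real.exp_le_exp.2 ((le_abs_self _).trans (hlT ω))
  refine ⟨i3, ?_⟩
  calc ∫ ω, Real.exp (l * T ω) ∂P
      ≤ ∫ ω, ((1 + l * T ω) + l ^ 2 * T ω ^ 2) ∂P := by
        refine integral_mono i3
          (((integrable_const 1).add (i1.const_mul l)).add (i2.const_mul _)) fun ω => ?_
        have := (abs_le.1 (Real.abs_exp_sub_one_sub_id_le (hlT ω))).2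
        have e : (l * T ω) ^ 2 = l ^ 2 * T ω ^ 2 := mul_pow _ _ _
        simp only
        linarith
    _ = (l * ∫ ω, T ω ∂P + l ^ 2 * ∫ ω, T ω ^ 2 ∂P) + 1 := by
        have j1 : Integrable (fun ω => 1 + l * T ω) P := (integrable_const 1).add (i1.const_mul l)
        rw [integral_add j1 (i2.const_mul _), integral_add (integrable_const 1) (i1.const_mul l), integral_const_mul,
          integral_const_mul]
        simp; ring
    _ ≤ Real.exp (l * ∫ ω, T ω ∂P + l ^ 2 * ∫ ω, T ω ^ 2 ∂P) := Real.add_one_le_exp _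
    _ ≤ _ := by gcongr; exact le_abs_self _

/-- One-sided Bernstein inequality for bounded, not necessarily centered variables. -/
lemma bernstein_upper {n : ℕ} {T : Fin n → Ω → ℝ} (hm : ∀ i, Measurable (T i))
    (hind : iIndepFun T P) {r V a s : ℝ} (hr : 0 < r) (hb : ∀ i ω, |T i ω| ≤ r)
    (hV : ∑ i, ∫ ω, T i ω ^ 2 ∂P ≤ V) (ha : ∑ i, |∫ ω, T i ω ∂P| ≤ a) (hs : 0 < s) :
    P.real {ω | a + 2 * Real.sqrt (s * V) + 2 * r * s ≤ ∑ i, T i ω} ≤ Real.exp (-s) := by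
  have key : ∀ l : ℝ, 0 < l → l * r ≤ 1 →
      a + l * V + s / l ≤ a + 2 * Real.sqrt (s * V) + 2 * r * s →
      P.real {ω | a + 2 * Real.sqrt (s * V) + 2 * r * s ≤ ∑ i, T i ω} ≤ Real.exp (-s) := by
    intro l hl hlr hx
    refine (measureReal_le_sum_le_exp hm hind hl.le
      (fun i => (integral_exp_mul_le (hm i) hl.le (hb i) hlr).1)
      (fun i => (integral_exp_mul_le (hm i) hl.le (hb i) hlr).2) _).trans ?_
    rw [Real.exp_le_exp, Finset.sum_add_distrib, ← Finset.mul_sum, ← Finset.mul_sum]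
    have h1 := mul_le_mul_of_nonneg_left hx hl.le
    have h2 := mul_le_mul_of_nonneg_left ha hl.le
    have h3 := mul_le_mul_of_nonneg_left hV (sq_nonneg l)
    have h4 : l * (a + l * V + s / l) = l * a + l ^ 2 * V + s := by field_simp
    linarith
  have hq := Real.sqrt_nonneg (s * V)
  -- The minimizer of lV + s/l is √(s/V). It is admissible only if l r ≤ 1; otherwise the endpoint
  -- 1/r is used.
  by_cases hc : V ≤ s * r ^ 2
  · refine key (1 / r) (by positivity) (by field_simp; rfl) ?_
    have h1 : 1 / r * V ≤ r * s := by
      rw [one_div_mul_eq_div, div_le_iff₀ hr]; linarith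
    have h2 : s / (1 / r) = r * s := by field_simp
    rw [h2]; linarith
  · push Not at hc
    have hV0 : 0 < V := lt_of_le_of_lt (by positivity) hc
    have hsV : 0 < s * V := by positivity
    have hq0 : 0 < Real.sqrt (s * V) := Real.sqrt_pos.2 hsV
    have hqq := Real.mul_self_sqrt hsV.le
    refine key (Real.sqrt (s * V) / V) (by positivity) ?_ ?_
    · rw [div_mul_eq_mul_div, div_le_one hV0]
      refine le_of_sq_le_sq ?_ hV0.le
      nlinarith
    · have h1 : Real.sqrt (s * V) / V * V = Real.sqrt (s * V) := by field_simp
      have h2 : s / (Real.sqrt (s * V) / V) = Real.sqrt (s * V) := by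
        rw [div_div_eq_mul_div, div_eq_iff hq0.ne']; linarith
      rw [h1, h2]
      have : 0 ≤ 2 * r * s := by positivity
      linarith

/-- Two-sided Bernstein inequality for bounded, not necessarily centered variables. -/
lemma bernstein_abs {n : ℕ} {T : Fin n → Ω → ℝ} (hm : ∀ i, Measurable (T i))
    (hind : iIndepFun T P) {r V a s : ℝ} (hr : 0 < r) (hb : ∀ i ω, |T i ω| ≤ r)
    (hV : ∑ i, ∫ ω, T i ω ^ 2 ∂P ≤ V) (ha : ∑ i, |∫ ω, T i ω ∂P| ≤ a) (hs : 0 < s) :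
    P.real {ω | a + 2 * Real.sqrt (s * V) + 2 * r * s ≤ |∑ i, T i ω|} ≤ 2 * Real.exp (-s) := by
  have h1 := bernstein_upper hm hind hr hb hV ha hs
  have h2 := bernstein_upper (P := P) (T := fun i ω => -T i ω) (fun i => (hm i).neg)
    (hind.comp (fun _ x => -x) (fun _ => measurable_neg)) hr
    (fun i ω => by simpa using hb i ω) (by simpa using hV)
    (by simpa [integral_neg] using ha) hs
  have h3 : {ω | a + 2 * Real.sqrt (s * V) + 2 * r * s ≤ |∑ i, T i ω|} ⊆
      {ω | a + 2 * Real.sqrt (s * V) + 2 * r * s ≤ ∑ i, T i ω} ∪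
      {ω | a + 2 * Real.sqrt (s * V) + 2 * r * s ≤ ∑ i, -T i ω} := by
    intro ω hω
    simpa [le_abs] using hω
  have h4 := (measureReal_mono h3).trans (measureReal_union_le (μ := P) _ _)
  linarith

end SubWeibull
end

/-! ### Exponential moments -/

noncomputable section

namespace SubWeibull

variable {Ω : Type*} [MeasurableSpace Ω] {P : Measure Ω}

lemma rpow_le_rpow_self_mul_exp {y s : ℝ} (hy : 0 ≤ y) (hs : 0 < s) :
    y ^ s ≤ s ^ s * Real.exp y := by
  have h1 : y / s ≤ Real.exp (y / s) := by linarith [Real.add_one_le_exp (y / s)]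
  have h2 := Real.rpow_le_rpow (by positivity) h1 hs.le
  rw [← Real.exp_mul, div_mul_cancel₀ _ hs.ne', Real.div_rpow hy hs.le,
    div_le_iff₀ (Real.rpow_pos_of_pos hs s)] at h2
  linarith

lemma le_mul_exp_rpow {x β : ℝ} (hx : 0 ≤ x) (hβ : 0 < β) :
    x ≤ (1 / β) ^ (1 / β) * Real.exp (x ^ β) := by
  have h := rpow_le_rpow_self_mul_exp (Real.rpow_nonneg hx β) (one_div_pos.2 hβ)
  rwa [← Real.rpow_mul hx, mul_one_div_cancel hβ.ne', Real.rpow_one] at h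

/-- Only half of the exponent is spent on |x|; the other half supplies the decay beyond the
truncation level. -/
lemma le_mul_exp_half_rpow {x β : ℝ} (hx : 0 ≤ x) (hβ : 0 < β) :
    x ≤ (2 / β) ^ (1 / β) * Real.exp (x ^ β / 2) := by
  have hz := Real.rpow_nonneg hx β
  have h := rpow_le_rpow_self_mul_exp (div_nonneg hz zero_le_two) (one_div_pos.2 hβ)
  have e : x = 2 ^ (1 / β) * (x ^ β / 2) ^ (1 / β) := by
    rw [← Real.mul_rpow (by norm_num) (by positivity), mul_div_cancel₀ _ (by norm_num),
      ← Real.rpow_mul hx, mul_one_div_cancel hβ.ne', Real.rpow_one]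
  have e2 : (2 / β) ^ (1 / β) = 2 ^ (1 / β) * (1 / β) ^ (1 / β) := by
    rw [← Real.mul_rpow (by norm_num) (by positivity)]; congr 1; ring
  rw [e2, mul_assoc]
  conv_lhs => rw [e]
  gcongr

lemma sq_le_mul_exp_rpow {x β : ℝ} (hx : 0 ≤ x) (hβ : 0 < β) :
    x ^ 2 ≤ (2 / β) ^ (2 / β) * Real.exp (x ^ β) := by
  have h := rpow_le_rpow_self_mul_exp (Real.rpow_nonneg hx β) (div_pos two_pos hβ)
  rwa [← Real.rpow_mul hx, mul_div_cancel₀ _ hβ.ne', Real.rpow_two] at h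

/-- `E exp(|Y| ^ β)` is finite and at most `B`. -/
def ExpMoment (P : Measure Ω) (β B : ℝ) (Y : Ω → ℝ) : Prop :=
  Integrable (fun ω => Real.exp (|Y ω| ^ β)) P ∧ ∫ ω, Real.exp (|Y ω| ^ β) ∂P ≤ B

lemma ExpMoment.nonneg {β B : ℝ} {Y : Ω → ℝ} (h : ExpMoment P β B Y) : 0 ≤ B :=
  (integral_nonneg fun _ => (Real.exp_pos _).le).trans h.2

/-- Domination by a multiple of the exponential moment. -/
lemma ExpMoment.integral_le {β B c : ℝ} {Y f : Ω → ℝ} (h : ExpMoment P β B Y)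
    (hf : Measurable f) (hc : 0 ≤ c) (hfY : ∀ ω, |f ω| ≤ c * Real.exp (|Y ω| ^ β)) :
    Integrable f P ∧ ∫ ω, f ω ∂P ≤ c * B ∧ |∫ ω, f ω ∂P| ≤ c * B := by
  have hi : Integrable f P := (h.1.const_mul c).mono' hf.aestronglyMeasurable
    (Filter.Eventually.of_forall hfY)
  have : |∫ ω, f ω ∂P| ≤ c * B := by
    refine (abs_integral_le_integral_abs).trans ?_
    refine (integral_mono hi.abs (h.1.const_mul c) hfY).trans ?_
    rw [integral_const_mul]
    exact mul_le_mul_of_nonneg_left h.2 hc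
  exact ⟨hi, (le_abs_self _).trans this, this⟩

lemma ExpMoment.integrable {β B : ℝ} {Y : Ω → ℝ} (h : ExpMoment P β B Y) (hY : Measurable Y)
    (hβ : 0 < β) : Integrable Y P ∧ |∫ ω, Y ω ∂P| ≤ (1 / β) ^ (1 / β) * B := by
  have := h.integral_le (f := Y) hY (c := (1 / β) ^ (1 / β)) (by positivity)
    fun ω => le_mul_exp_rpow (abs_nonneg _) hβ
  exact ⟨this.1, this.2.2⟩

lemma ExpMoment.integrable_sq {β B : ℝ} {Y : Ω → ℝ} (h : ExpMoment P β B Y) (hY : Measurable Y)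
    (hβ : 0 < β) : Integrable (fun ω => Y ω ^ 2) P :=
  (h.integral_le (hY.pow_const 2) (c := (2 / β) ^ (2 / β)) (by positivity)
    fun ω => by rw [abs_pow]; exact sq_le_mul_exp_rpow (abs_nonneg _) hβ).1

lemma ExpMoment.congr_le {β B B' γ : ℝ} {Y Z : Ω → ℝ} (h : ExpMoment P β B Y)
    (hZ : Measurable Z) {c : ℝ} (hc : 0 ≤ c)
    (hle : ∀ ω, Real.exp (|Z ω| ^ γ) ≤ c * Real.exp (|Y ω| ^ β)) (hB : c * B ≤ B') :
    ExpMoment P γ B' Z := by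
  have := h.integral_le (f := fun ω => Real.exp (|Z ω| ^ γ))
    (by fun_prop) hc fun ω => by rw [abs_of_pos (Real.exp_pos _)]; exact hle ω
  exact ⟨this.1, this.2.1.trans hB⟩

/-- Shifting by a bounded constant and halving. -/
lemma ExpMoment.shift {β B d m : ℝ} {Y : Ω → ℝ} (h : ExpMoment P β B Y) (hY : Measurable Y)
    (hβ : 0 < β) (hm : |m| ≤ d) :
    ExpMoment P β (Real.exp (d ^ β) * B) (fun ω => (Y ω - m) / 2) := by
  have hd : 0 ≤ d := (abs_nonneg _).trans hm
  refine h.congr_le (by fun_prop) (Real.exp_pos _).le (fun ω => ?_) le_rfl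
  rw [← Real.exp_add, Real.exp_le_exp]
  -- Halving turns the sum d + |Y| into a maximum, so the exponent is not multiplied by a constant,
  -- whatever β is.
  have h1 : |(Y ω - m) / 2| ≤ max d |Y ω| := by
    rw [abs_div, abs_two, div_le_iff₀ two_pos]
    have := abs_sub (Y ω) m
    have := le_max_left d |Y ω|
    have := le_max_right d |Y ω|
    linarith
  refine (Real.rpow_le_rpow (abs_nonneg _) h1 hβ.le).trans ?_
  have h2 := Real.rpow_nonneg hd β
  have h3 := Real.rpow_nonneg (abs_nonneg (Y ω)) β
  rcases max_choice d |Y ω| with h | h <;> rw [h] <;> linarith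

/-- A product of two variables loses a factor two in the exponent. -/
lemma ExpMoment.mul {α B : ℝ} {Y Z : Ω → ℝ} (hY : ExpMoment P α B Y) (hZ : ExpMoment P α B Z)
    (mY : Measurable Y) (mZ : Measurable Z) :
    ExpMoment P (α / 2) B (fun ω => Y ω * Z ω) := by
  have hle : ∀ ω, Real.exp (|Y ω * Z ω| ^ (α / 2)) ≤
      (2 : ℝ)⁻¹ * Real.exp (|Y ω| ^ α) + (2 : ℝ)⁻¹ * Real.exp (|Z ω| ^ α) := by
    intro ω
    have e : ∀ x : ℝ, |x| ^ α = (|x| ^ (α / 2)) ^ 2 := fun x => by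
      rw [← Real.rpow_natCast, ← Real.rpow_mul (abs_nonneg _)]; congr 1; push_cast; ring
    rw [abs_mul, Real.mul_rpow (abs_nonneg _) (abs_nonneg _), e (Y ω), e (Z ω)]
    set u := |Y ω| ^ (α / 2)
    set v := |Z ω| ^ (α / 2)
    -- With |YZ|^{α/2} = uv ≤ (u² + v²)/2, convexity of exp averages the two moments, so B is
    -- preserved.
    have hc := convexOn_exp.2 (Set.mem_univ (u ^ 2)) (Set.mem_univ (v ^ 2))
      (by norm_num : (0 : ℝ) ≤ 2⁻¹) (by norm_num : (0 : ℝ) ≤ 2⁻¹) (by norm_num)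
    simp only [smul_eq_mul] at hc
    refine le_trans (Real.exp_le_exp.2 ?_) hc
    nlinarith [sq_nonneg (u - v)]
  have hi := (hY.1.const_mul (2 : ℝ)⁻¹).add (hZ.1.const_mul (2 : ℝ)⁻¹)
  have hi' : Integrable (fun ω => Real.exp (|Y ω * Z ω| ^ (α / 2))) P := by
    refine hi.mono' (Measurable.aestronglyMeasurable (by fun_prop)) (Filter.Eventually.of_forall fun ω => ?_)
    rw [Real.norm_eq_abs, abs_of_pos (Real.exp_pos _)]
    exact hle ω
  refine ⟨hi', (integral_mono hi' hi hle).trans ?_⟩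
  simp only [Pi.add_apply]
  rw [integral_add (hY.1.const_mul (2 : ℝ)⁻¹) (hZ.1.const_mul (2 : ℝ)⁻¹), integral_const_mul,
    integral_const_mul]
  linarith [hY.2, hZ.2]

/-! ### Truncation at the logarithmic level -/

/-- Truncation at level `r`. -/
def trunc (r x : ℝ) : ℝ := if |x| ≤ r then x else 0

/-- The `β`-th power of the part of `x` removed by truncation at level `r`. -/
def tailPow (β r x : ℝ) : ℝ := if |x| ≤ r then 0 else |x| ^ β

lemma measurable_trunc (r : ℝ) : Measurable (trunc r) :=
  Measurable.ite (measurableSet_le (by fun_prop) (by fun_prop)) measurable_id measurable_const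

lemma measurable_tailPow (β r : ℝ) : Measurable (tailPow β r) :=
  Measurable.ite (measurableSet_le (by fun_prop) (by fun_prop)) measurable_const (by fun_prop)

lemma abs_trunc_le {r : ℝ} (hr : 0 ≤ r) (x : ℝ) : |trunc r x| ≤ r := by
  unfold trunc; split_ifs with h
  · exact h
  · simpa using hr

lemma trunc_sq_le (r x : ℝ) : trunc r x ^ 2 ≤ x ^ 2 := by
  unfold trunc; split_ifs
  · rfl
  · simpa using sq_nonneg x

lemma tailPow_nonneg (β r x : ℝ) : 0 ≤ tailPow β r x := by
  unfold tailPow; split_ifs <;> positivity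

lemma abs_sub_trunc {β : ℝ} (hβ : 0 < β) (r x : ℝ) :
    |x - trunc r x| = tailPow β r x ^ (1 / β) := by
  unfold trunc tailPow; split_ifs
  · rw [sub_self, abs_zero, Real.zero_rpow (one_div_pos.2 hβ).ne']
  · rw [sub_zero, ← Real.rpow_mul (abs_nonneg _), mul_one_div_cancel hβ.ne', Real.rpow_one]

lemma exp_half_le {β r x : ℝ} (hβ : 0 < β) (hr : 0 ≤ r) (hx : r ≤ |x|) :
    Real.exp (|x| ^ β / 2) ≤ Real.exp (-(r ^ β / 2)) * Real.exp (|x| ^ β) := by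
  rw [← Real.exp_add, Real.exp_le_exp]
  linarith [Real.rpow_le_rpow hr hx hβ.le]

lemma exp_tailPow_le {β r : ℝ} (hβ : 0 < β) (hr : 0 ≤ r) (x : ℝ) :
    Real.exp (2⁻¹ * tailPow β r x) ≤ 1 + Real.exp (-(r ^ β / 2)) * Real.exp (|x| ^ β) := by
  unfold tailPow; split_ifs with h
  · simp only [mul_zero, Real.exp_zero, le_add_iff_nonneg_right]; positivity
  · have := exp_half_le hβ hr (not_le.1 h).le
    rw [inv_mul_eq_div]; linarith

lemma abs_sub_trunc_le {β r : ℝ} (hβ : 0 < β) (hr : 0 ≤ r) (x : ℝ) :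
    |trunc r x - x| ≤ (2 / β) ^ (1 / β) * Real.exp (-(r ^ β / 2)) * Real.exp (|x| ^ β) := by
  unfold trunc; split_ifs with h
  · rw [sub_self, abs_zero]; positivity
  · have h1 := exp_half_le hβ hr (not_le.1 h).le
    have h2 := le_mul_exp_half_rpow (abs_nonneg x) hβ
    rw [zero_sub, abs_neg, mul_assoc]
    refine h2.trans ?_
    gcongr

/-- The truncation level for `n` summands. -/
def level (β : ℝ) (n : ℕ) : ℝ := (2 * Real.log (2 * n)) ^ (1 / β)

lemma one_le_two_mul_log {n : ℕ} (hn : 1 ≤ n) : 1 ≤ 2 * Real.log (2 * n) := by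
  have h : Real.log 2 ≤ Real.log (2 * n) := by
    apply Real.log_le_log two_pos
    have : (1 : ℝ) ≤ n := by exact_mod_cast hn
    linarith
  linarith [Real.log_two_gt_d9]

lemma one_le_level {β : ℝ} (hβ : 0 < β) {n : ℕ} (hn : 1 ≤ n) : 1 ≤ level β n :=
  Real.one_le_rpow (one_le_two_mul_log hn) (by positivity)

lemma exp_neg_level {β : ℝ} (hβ : 0 < β) {n : ℕ} (hn : 1 ≤ n) :
    Real.exp (-(level β n ^ β / 2)) = (2 * (n : ℝ))⁻¹ := by
  have h := one_le_two_mul_log hn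
  have hn' : (1 : ℝ) ≤ n := by exact_mod_cast hn
  rw [level, ← Real.rpow_mul (by linarith), one_div_mul_cancel hβ.ne', Real.rpow_one,
    mul_div_cancel_left₀ _ two_ne_zero, Real.exp_neg, Real.exp_log (by positivity)]

variable [IsProbabilityMeasure P]

/-- Each moment at l = 1/2 is at most 1 + B/(2n) ≤ exp(B/(2n)). The n factors multiply to exp(B/2),
which the B in the threshold cancels. -/
lemma tail_sum {n : ℕ} (hn : 1 ≤ n) {β B : ℝ} (hβ : 0 < β) {W : Fin n → Ω → ℝ}
    (hm : ∀ i, Measurable (W i)) (hind : iIndepFun W P) (hW : ∀ i, ExpMoment P β B (W i)) (s : ℝ) :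
    P.real {ω | 2 * s + B ≤ ∑ i, tailPow β (level β n) (W i ω)} ≤ Real.exp (-s) := by
  have hn' : (1 : ℝ) ≤ n := by exact_mod_cast hn
  have hr : 0 ≤ level β n := zero_le_one.trans (one_le_level hβ hn)
  have hmt := measurable_tailPow β (level β n)
  have hle : ∀ i ω, Real.exp (2⁻¹ * tailPow β (level β n) (W i ω)) ≤
      1 + (2 * (n : ℝ))⁻¹ * Real.exp (|W i ω| ^ β) := fun i ω => by
    rw [← exp_neg_level hβ hn]; exact exp_tailPow_le hβ hr _
  have hi : ∀ i, Integrable (fun ω => 1 + (2 * (n : ℝ))⁻¹ * Real.exp (|W i ω| ^ β)) P :=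
    fun i => (integrable_const 1).add ((hW i).1.const_mul _)
  have hi2 : ∀ i, Integrable (fun ω => Real.exp (2⁻¹ * tailPow β (level β n) (W i ω))) P := by
    intro i
    refine (hi i).mono' ((hmt.comp (hm i)).const_mul _).exp.aestronglyMeasurable
      (Filter.Eventually.of_forall fun ω => ?_)
    rw [Real.norm_eq_abs, abs_of_pos (Real.exp_pos _)]
    exact hle i ω
  refine (measureReal_le_sum_le_exp (T := fun i ω => tailPow β (level β n) (W i ω))
    (l := 2⁻¹) (b := fun _ => (2 * (n : ℝ))⁻¹ * B)
    (fun i => hmt.comp (hm i)) (hind.comp _ fun _ => hmt) (by norm_num) hi2 ?_ _).trans ?_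
  · intro i
    refine (integral_mono (hi2 i) (hi i) (hle i)).trans ?_
    rw [integral_add (integrable_const 1) ((hW i).1.const_mul _), integral_const_mul]
    simp only [integral_const, probReal_univ, smul_eq_mul, mul_one]
    refine le_trans ?_ (Real.add_one_le_exp _)
    have := mul_le_mul_of_nonneg_left (hW i).2 (by positivity : 0 ≤ (2 * (n : ℝ))⁻¹)
    linarith
  · rw [Real.exp_le_exp, Finset.sum_const, Finset.card_univ, Fintype.card_fin, nsmul_eq_mul]
    apply le_of_eq
    field_simp
    ring

/-- Since W is centered, the bias is minus the mean of the removed part, and that carries the factor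
exp(-r^β/2) = 1/(2n). -/
lemma abs_integral_trunc_le {n : ℕ} (hn : 1 ≤ n) {β B : ℝ} (hβ : 0 < β) {W : Ω → ℝ}
    (hm : Measurable W) (hW : ExpMoment P β B W) (h0 : ∫ ω, W ω ∂P = 0) :
    |∫ ω, trunc (level β n) (W ω) ∂P| ≤ (2 / β) ^ (1 / β) * (2 * (n : ℝ))⁻¹ * B := by
  have hr : 0 ≤ level β n := zero_le_one.trans (one_le_level hβ hn)
  have hmt : Measurable fun ω => trunc (level β n) (W ω) := (measurable_trunc _).comp hm
  have h1 := (hW.integral_le (f := fun ω => trunc (level β n) (W ω) - W ω) (hmt.sub hm)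
    (by positivity) fun ω => abs_sub_trunc_le hβ hr _).2.2
  rw [integral_sub (integrable_of_abs_le hmt fun ω => abs_trunc_le hr _)
    (hW.integrable hm hβ).1, h0, sub_zero, exp_neg_level hβ hn] at h1
  exact h1

/-- Bernstein's inequality for the truncated summands together with the bound for the tails. -/
lemma truncated_sum {n : ℕ} (hn : 1 ≤ n) {β B V s : ℝ} (hβ : 0 < β) {W : Fin n → Ω → ℝ}
    (hm : ∀ i, Measurable (W i)) (hind : iIndepFun W P) (hW : ∀ i, ExpMoment P β B (W i))
    (h0 : ∀ i, ∫ ω, W i ω ∂P = 0) (hs : 0 < s)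
    (hV : ∑ i, ∫ ω, trunc (level β n) (W i ω) ^ 2 ∂P ≤ V) :
    P.real {ω | (2 / β) ^ (1 / β) * B + 2 * Real.sqrt (s * V) + 2 * level β n * s ≤
        |∑ i, trunc (level β n) (W i ω)| ∨
      2 * s + B ≤ ∑ i, tailPow β (level β n) (W i ω)} ≤ 3 * Real.exp (-s) := by
  have hn' : (1 : ℝ) ≤ n := by exact_mod_cast hn
  have hr : 0 < level β n := zero_lt_one.trans_le (one_le_level hβ hn)
  have hB : 0 ≤ B := (hW ⟨0, hn⟩).nonneg
  have hmt := measurable_trunc (level β n)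
  have ha : ∑ i, |∫ ω, trunc (level β n) (W i ω) ∂P| ≤ (2 / β) ^ (1 / β) * B := by
    refine (Finset.sum_le_sum fun i _ =>
      abs_integral_trunc_le hn hβ (hm i) (hW i) (h0 i)).trans ?_
    rw [Finset.sum_const, Finset.card_univ, Fintype.card_fin, nsmul_eq_mul]
    have hc : 0 ≤ (2 / β) ^ (1 / β) * B := by positivity
    calc (n : ℝ) * ((2 / β) ^ (1 / β) * (2 * (n : ℝ))⁻¹ * B)
        = (2 / β) ^ (1 / β) * B / 2 := by field_simp
      _ ≤ _ := by linarith
  have h1 := bernstein_abs (T := fun i ω => trunc (level β n) (W i ω))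
    (fun i => hmt.comp (hm i)) (hind.comp _ fun _ => hmt) hr
    (fun i ω => abs_trunc_le hr.le _) hV ha hs
  have h2 := tail_sum hn hβ hm hind hW s
  have h3 := measureReal_union_le (μ := P)
    {ω | (2 / β) ^ (1 / β) * B + 2 * Real.sqrt (s * V) + 2 * level β n * s ≤
        |∑ i, trunc (level β n) (W i ω)|}
    {ω | 2 * s + B ≤ ∑ i, tailPow β (level β n) (W i ω)}
  rw [Set.ofPred_or]
  linarith

end SubWeibull
end

/-! ### Deviation inequalities for sums -/

noncomputable section

namespace SubWeibull

variable {Ω : Type*} [MeasurableSpace Ω] {P : Measure Ω} [IsProbabilityMeasure P]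

/-- Write v^q = v · v^{q-1} and bound each v_i in the second factor by the whole sum. -/
lemma sum_rpow_le_rpow_sum {n : ℕ} {v : Fin n → ℝ} (hv : ∀ i, 0 ≤ v i) {q : ℝ} (hq : 1 ≤ q) :
    ∑ i, v i ^ q ≤ (∑ i, v i) ^ q := by
  have h0 : 0 ≤ ∑ i, v i := Finset.sum_nonneg fun i _ => hv i
  have e : ∀ x : ℝ, 0 ≤ x → x ^ q = x * x ^ (q - 1) := fun x hx => by
    rw [← Real.rpow_one_add' hx (by linarith)]; congr 1; ring
  rw [e _ h0, Finset.sum_mul]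
  refine Finset.sum_le_sum fun i _ => ?_
  rw [e _ (hv i)]
  refine mul_le_mul_of_nonneg_left (Real.rpow_le_rpow (hv i) ?_ (by linarith)) (hv i)
  exact Finset.single_le_sum (f := v) (fun i _ => hv i) (Finset.mem_univ i)

/-- Cauchy–Schwarz against the constant 1 doubles the exponent, and 2q ≥ 1 brings in the previous
bound. -/
lemma sum_rpow_le_sqrt_mul_rpow_sum {n : ℕ} {v : Fin n → ℝ} (hv : ∀ i, 0 ≤ v i) {q : ℝ}
    (hq : 1 / 2 ≤ q) : ∑ i, v i ^ q ≤ Real.sqrt n * (∑ i, v i) ^ q := by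
  have h0 : 0 ≤ ∑ i, v i := Finset.sum_nonneg fun i _ => hv i
  have e : ∀ x : ℝ, 0 ≤ x → (x ^ q) ^ 2 = x ^ (2 * q) := fun x hx => by
    rw [← Real.rpow_natCast, ← Real.rpow_mul hx]; congr 1; push_cast; ring
  refine le_of_sq_le_sq ?_ (by positivity)
  rw [mul_pow, Real.sq_sqrt (by positivity), e _ h0]
  have h1 := sq_sum_le_card_mul_sum_sq (s := Finset.univ) (f := fun i => v i ^ q)
  rw [Finset.card_univ, Fintype.card_fin] at h1
  refine h1.trans (mul_le_mul_of_nonneg_left ?_ (by positivity))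
  refine le_trans (le_of_eq ?_) (sum_rpow_le_rpow_sum hv (q := 2 * q) (by linarith))
  exact Finset.sum_congr rfl fun i _ => e _ (hv i)

lemma abs_sum_le_trunc_add_tail {n : ℕ} {β : ℝ} (hβ : 0 < β) (r : ℝ) (w : Fin n → ℝ) :
    |∑ i, w i| ≤ |∑ i, trunc r (w i)| + ∑ i, tailPow β r (w i) ^ (1 / β) := by
  have e : ∑ i, w i = ∑ i, trunc r (w i) + ∑ i, (w i - trunc r (w i)) := by
    rw [← Finset.sum_add_distrib]; simp
  rw [e]
  refine (abs_add_le _ _).trans (add_le_add le_rfl ?_)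
  refine (Finset.abs_sum_le_sum_abs _ _).trans (Finset.sum_le_sum fun i _ => ?_)
  rw [abs_sub_trunc hβ]

/-- The constant of the two deviation bounds below. -/
def devConst (β B : ℝ) : ℝ :=
  ((2 / β) ^ (1 / β) * B + 4 + (2 + B) ^ (1 / β)) * 2 ^ (1 / β)

lemma devConst_pos {β B : ℝ} (hβ : 0 < β) (hB : 0 ≤ B) : 0 < devConst β B := by
  unfold devConst; positivity

lemma level_eq {β : ℝ} {n : ℕ} (hn : 1 ≤ n) :
    level β n = 2 ^ (1 / β) * Real.log (2 * n) ^ (1 / β) := by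
  have := one_le_two_mul_log hn
  rw [level, Real.mul_rpow two_pos.le (by linarith)]

/-- All terms are absorbed into `level β n * s ^ (1 / β)`, as both factors are at least 1; the
2^{1/β} in `devConst` comes from the level. -/
lemma devConst_bound {n : ℕ} (hn : 1 ≤ n) {β B s : ℝ} (hβ : 0 < β) (hB : 0 ≤ B) (hs : 1 ≤ s) :
    (2 / β) ^ (1 / β) * B + 4 * level β n * s ^ (1 / β) + (2 * s + B) ^ (1 / β) ≤
      devConst β B * (Real.log (2 * n) ^ (1 / β) * s ^ (1 / β)) := by
  have hl := one_le_level hβ hn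
  have hq : 0 ≤ 1 / β := by positivity
  have hs1 : 1 ≤ s ^ (1 / β) := Real.one_le_rpow hs hq
  have h1 : (2 * s + B) ^ (1 / β) ≤ (2 + B) ^ (1 / β) * s ^ (1 / β) := by
    rw [← Real.mul_rpow (by linarith) (by linarith)]
    refine Real.rpow_le_rpow (by linarith) ?_ hq
    nlinarith
  have e : devConst β B * (Real.log (2 * n) ^ (1 / β) * s ^ (1 / β)) =
      ((2 / β) ^ (1 / β) * B + 4 + (2 + B) ^ (1 / β)) * (level β n * s ^ (1 / β)) := by
    rw [level_eq hn, devConst]; ring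
  rw [e]
  have h2 : 1 ≤ level β n * s ^ (1 / β) := one_le_mul_of_one_le_of_one_le hl hs1
  have h3 : s ^ (1 / β) ≤ level β n * s ^ (1 / β) := le_mul_of_one_le_left (by linarith) hl
  have c1 : 0 ≤ (2 / β) ^ (1 / β) * B := by positivity
  have c2 : 0 ≤ (2 + B) ^ (1 / β) := by positivity
  have h4 := mul_le_mul_of_nonneg_left h2 c1
  have h5 := mul_le_mul_of_nonneg_left h3 c2
  nlinarith

/-- Deviation of a sum with the exact variance in the leading term, for `β ≤ 1`. -/
lemma deviation_variance {n : ℕ} (hn : 1 ≤ n) {β B V s : ℝ} (hβ : 0 < β) (hβ1 : β ≤ 1)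
    {W : Fin n → Ω → ℝ} (hm : ∀ i, Measurable (W i)) (hind : iIndepFun W P)
    (hW : ∀ i, ExpMoment P β B (W i)) (h0 : ∀ i, ∫ ω, W i ω ∂P = 0) (hs : 1 ≤ s)
    (hV : ∑ i, ∫ ω, W i ω ^ 2 ∂P ≤ V) :
    P.real {ω | 2 * Real.sqrt (s * V) +
        devConst β B * (Real.log (2 * n) ^ (1 / β) * s ^ (1 / β)) < |∑ i, W i ω|} ≤
      3 * Real.exp (-s) := by
  have hB : 0 ≤ B := (hW ⟨0, hn⟩).nonneg
  have hq : 1 ≤ 1 / β := by rwa [le_div_iff₀ hβ, one_mul]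
  have hl := one_le_level hβ hn
  have hV' : ∑ i, ∫ ω, trunc (level β n) (W i ω) ^ 2 ∂P ≤ V := by
    refine (Finset.sum_le_sum fun i _ => ?_).trans hV
    exact integral_mono_of_nonneg (Filter.Eventually.of_forall fun _ => sq_nonneg _)
      ((hW i).integrable_sq (hm i) hβ) (Filter.Eventually.of_forall fun _ => trunc_sq_le _ _)
  refine (measureReal_mono fun ω hω => ?_).trans
    (truncated_sum hn hβ hm hind hW h0 (by linarith) hV')
  by_contra hc
  simp only [Set.mem_ofPred_eq, not_or, not_le] at hc hω
  have h1 := abs_sum_le_trunc_add_tail hβ (level β n) fun i => W i ω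
  have h2 := sum_rpow_le_rpow_sum
    (fun i => tailPow_nonneg β (level β n) (W i ω)) hq
  have h3 := Real.rpow_le_rpow
    (Finset.sum_nonneg fun i _ => tailPow_nonneg β (level β n) (W i ω)) hc.2.le
    (by linarith : 0 ≤ 1 / β)
  have h4 := devConst_bound hn hβ hB hs
  have h5 : s ≤ s ^ (1 / β) := Real.self_le_rpow_of_one_le hs hq
  have h6 := mul_le_mul_of_nonneg_left h5 (by linarith : 0 ≤ 2 * level β n)
  have h7 : 0 ≤ level β n * s ^ (1 / β) := by positivity
  linarith [hc.1]

/-- Deviation of a sum at the scale `√n`, for `β ≤ 2`. -/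
lemma deviation_sqrt {n : ℕ} (hn : 1 ≤ n) {β B s : ℝ} (hβ : 0 < β) (hβ2 : β ≤ 2)
    {W : Fin n → Ω → ℝ} (hm : ∀ i, Measurable (W i)) (hind : iIndepFun W P)
    (hW : ∀ i, ExpMoment P β B (W i)) (h0 : ∀ i, ∫ ω, W i ω ∂P = 0) (hs : 1 ≤ s) :
    P.real {ω | Real.sqrt n *
        (devConst β B * (Real.log (2 * n) ^ (1 / β) * s ^ (1 / β))) < |∑ i, W i ω|} ≤
      3 * Real.exp (-s) := by
  have hB : 0 ≤ B := (hW ⟨0, hn⟩).nonneg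
  have hn' : (1 : ℝ) ≤ n := by exact_mod_cast hn
  have hq : 1 / 2 ≤ 1 / β := one_div_le_one_div_of_le hβ hβ2
  have hl := one_le_level hβ hn
  have hsn : 1 ≤ Real.sqrt n := Real.one_le_sqrt.2 hn'
  have hmt := measurable_trunc (level β n)
  have hV' : ∑ i, ∫ ω, trunc (level β n) (W i ω) ^ 2 ∂P ≤ n * level β n ^ 2 := by
    have : ∀ i, ∫ ω, trunc (level β n) (W i ω) ^ 2 ∂P ≤ level β n ^ 2 := fun i => by
      have := integral_mono_of_nonneg (μ := P) (g := fun _ => level β n ^ 2)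
        (Filter.Eventually.of_forall fun ω => sq_nonneg (trunc (level β n) (W i ω)))
        (integrable_const _) (Filter.Eventually.of_forall fun ω =>
          sq_le_sq' (abs_le.1 (abs_trunc_le (by linarith) _)).1
            (abs_le.1 (abs_trunc_le (by linarith) _)).2)
      simpa using this
    refine (Finset.sum_le_sum fun i _ => this i).trans ?_
    simp
  refine (measureReal_mono fun ω hω => ?_).trans
    (truncated_sum hn hβ hm hind hW h0 (by linarith) hV')
  by_contra hc
  simp only [Set.mem_ofPred_eq, not_or, not_le] at hc hω
  have h1 := abs_sum_le_trunc_add_tail hβ (level β n) fun i => W i ω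
  have h2 := sum_rpow_le_sqrt_mul_rpow_sum
    (fun i => tailPow_nonneg β (level β n) (W i ω)) hq
  have h3 := Real.rpow_le_rpow
    (Finset.sum_nonneg fun i _ => tailPow_nonneg β (level β n) (W i ω)) hc.2.le
    (by positivity : 0 ≤ 1 / β)
  have h3' := mul_le_mul_of_nonneg_left h3 (Real.sqrt_nonneg n)
  have h4 := mul_le_mul_of_nonneg_left (devConst_bound hn hβ hB hs) (Real.sqrt_nonneg n)
  have h5 : Real.sqrt s ≤ s ^ (1 / β) := by
    rw [Real.sqrt_eq_rpow]; exact Real.rpow_le_rpow_of_exponent_le hs hq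
  have h6 : |∑ i, trunc (level β n) (W i ω)| ≤
      Real.sqrt n * ((2 / β) ^ (1 / β) * B + 4 * level β n * Real.sqrt s) := by
    have c1 : 0 ≤ (2 / β) ^ (1 / β) * B := by positivity
    have hss : Real.sqrt s * Real.sqrt s = s := Real.mul_self_sqrt (by linarith)
    have hnn : Real.sqrt n * Real.sqrt n = n := Real.mul_self_sqrt (by linarith)
    have hs0 := Real.sqrt_nonneg s
    have c2 := mul_le_mul_of_nonneg_right hsn c1
    -- With the crude V = n r², Bernstein gives 2r√(sn) + 2rs, which is at most 4r√n√s when s ≤ n.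
    -- For s ≥ n the trivial bound nr ≤ r√n√s suffices.
    rcases le_total s n with hle | hle
    · have d1 : Real.sqrt (s * (n * level β n ^ 2)) = Real.sqrt s * (Real.sqrt n * level β n) := by
        rw [Real.sqrt_mul (by linarith), Real.sqrt_mul (by linarith),
          Real.sqrt_sq (by linarith)]
      have d2 : Real.sqrt s ≤ Real.sqrt n := Real.sqrt_le_sqrt hle
      have d3 := mul_le_mul_of_nonneg_right d2 (mul_nonneg (zero_le_one.trans hl) hs0)
      have d4 : level β n * s = Real.sqrt s * (level β n * Real.sqrt s) := by
        linear_combination -(level β n) * hss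
      rw [d1] at hc
      nlinarith [hc.1]
    · have d2 : Real.sqrt n ≤ Real.sqrt s := Real.sqrt_le_sqrt hle
      have d1 : |∑ i, trunc (level β n) (W i ω)| ≤ n * level β n := by
        refine (Finset.abs_sum_le_sum_abs _ _).trans ?_
        refine (Finset.sum_le_sum fun i _ => abs_trunc_le (by linarith) _).trans ?_
        simp
      have d3 := mul_le_mul_of_nonneg_left d2
        (mul_nonneg (zero_le_one.trans hl) (Real.sqrt_nonneg n))
      have d4 : (n : ℝ) * level β n = level β n * Real.sqrt n * Real.sqrt n := by
        rw [mul_assoc, hnn]; ring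
      have d5 : 0 ≤ level β n * Real.sqrt n * Real.sqrt s := by positivity
      nlinarith
  have h7 := mul_le_mul_of_nonneg_left h5 (by positivity : 0 ≤ Real.sqrt n * (4 * level β n))
  nlinarith

end SubWeibull
end

/-! ### Decomposition of the covariance error and its two pieces -/

noncomputable section

namespace SubWeibull

lemma centered_sum_identity {n : ℕ} (hn : 1 ≤ n) (x y c : Fin n → ℝ) (a b : ℝ) :
    (n : ℝ)⁻¹ * ∑ i, (x i - (n : ℝ)⁻¹ * ∑ l, x l) * (y i - (n : ℝ)⁻¹ * ∑ l, y l) -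
        (n : ℝ)⁻¹ * ∑ i, c i =
      (n : ℝ)⁻¹ * ∑ i, ((x i - a) * (y i - b) - c i) -
        ((n : ℝ)⁻¹ * ∑ l, x l - a) * ((n : ℝ)⁻¹ * ∑ l, y l - b) := by
  have hn' : (n : ℝ) ≠ 0 := by positivity
  have h : ∀ u v : ℝ, ∑ i, (x i - u) * (y i - v) =
      ∑ i, x i * y i - v * ∑ i, x i - u * ∑ i, y i + n * (u * v) := fun u v => by
    have : ∀ i, (x i - u) * (y i - v) = x i * y i - v * x i - u * y i + u * v := fun i => by ring
    simp only [this, Finset.sum_add_distrib, Finset.sum_sub_distrib, Finset.mul_sum]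
    simp
  rw [Finset.sum_sub_distrib, h, h]
  field_simp
  ring

lemma sampleMean_apply {Ω : Type*} {n p : ℕ} (X : Fin n → Ω → Fin p → ℝ) (ω : Ω) (j : Fin p) :
    sampleMean X ω j = (n : ℝ)⁻¹ * ∑ i, X i ω j := by
  simp [sampleMean]

variable {Ω : Type*} [MeasurableSpace Ω] {P : Measure Ω}

lemma sampleCov_sub_popCov_apply {n p : ℕ} (hn : 1 ≤ n) (X : Fin n → Ω → Fin p → ℝ) (ω : Ω)
    (j k : Fin p) :
    (sampleCov X ω - popCov P X) j k =
      (n : ℝ)⁻¹ * ∑ i, ((X i ω j - meanVec P X j) * (X i ω k - meanVec P X k) -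
        ∫ ω', (X i ω' j - meanVec P X j) * (X i ω' k - meanVec P X k) ∂P) -
      (sampleMean X ω j - meanVec P X j) * (sampleMean X ω k - meanVec P X k) := by
  have h := centered_sum_identity hn (fun i => X i ω j) (fun i => X i ω k)
    (fun i => ∫ ω', (X i ω' j - meanVec P X j) * (X i ω' k - meanVec P X k) ∂P)
    (meanVec P X j) (meanVec P X k)
  simp only [sampleMean_apply]
  rw [← h]
  simp [sampleCov, popCov, Matrix.sum_apply, Matrix.vecMulVec_apply, sampleMean_apply]

lemma meanVec_apply {n p : ℕ} {X : Fin n → Ω → Fin p → ℝ} {j : Fin p}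
    (h : ∀ i, Integrable (fun ω => X i ω j) P) :
    meanVec P X j = (n : ℝ)⁻¹ * ∑ i, ∫ ω, X i ω j ∂P := by
  simp only [meanVec, sampleMean_apply]
  rw [integral_const_mul, integral_finsetSum _ fun i _ => h i]

/-- The supremum runs over j ≤ k only; symmetry of the product covers the other pairs. -/
lemma le_maxStdDev {n p : ℕ} (X : Fin n → Ω → Fin p → ℝ) (j k : Fin p) :
    Real.sqrt ((n : ℝ)⁻¹ * ∑ i, variance
      (fun ω => (X i ω j - meanVec P X j) * (X i ω k - meanVec P X k)) P) ≤ maxStdDev P X := by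
  rcases le_total j k with h | h
  · exact le_ciSup (f := fun jk : {jk : Fin p × Fin p // jk.1 ≤ jk.2} =>
      Real.sqrt ((n : ℝ)⁻¹ * ∑ i, variance
      (fun ω => (X i ω jk.1.1 - meanVec P X jk.1.1) * (X i ω jk.1.2 - meanVec P X jk.1.2)) P))
      (Set.finite_range _).bddAbove ⟨(j, k), h⟩
  · simp only [mul_comm (_ - meanVec P X j)]
    exact le_ciSup (f := fun jk : {jk : Fin p × Fin p // jk.1 ≤ jk.2} =>
      Real.sqrt ((n : ℝ)⁻¹ * ∑ i, variance
      (fun ω => (X i ω jk.1.1 - meanVec P X jk.1.1) * (X i ω jk.1.2 - meanVec P X jk.1.2)) P))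
      (Set.finite_range _).bddAbove ⟨(k, j), h⟩

/-- Bound for the mean of a variable with `E exp(|Y| ^ β) ≤ B`. -/
def meanConst (β B : ℝ) : ℝ := (1 / β) ^ (1 / β) * B

/-- Exponential moment after centering and halving. -/
def shiftConst (β B : ℝ) : ℝ := Real.exp (meanConst β B ^ β) * B

lemma ExpMoment.center {β B : ℝ} {Y : Ω → ℝ} (h : ExpMoment P β B Y) (hY : Measurable Y)
    (hβ : 0 < β) : ExpMoment P β (shiftConst β B) (fun ω => (Y ω - ∫ ω', Y ω' ∂P) / 2) :=
  h.shift hY hβ (h.integrable hY hβ).2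

variable [IsProbabilityMeasure P]

/-- A finite Orlicz norm controls the exponential moment at every larger scale. -/
lemma ExpMoment.of_orliczNorm_lt {α K : ℝ} (hα : 0 < α) {Y : Ω → ℝ} (hY : Measurable Y)
    (h : orliczNorm P (psi α) Y < ENNReal.ofReal K) : ExpMoment P α 2 (fun ω => Y ω / K) := by
  unfold orliczNorm at h
  simp only [iInf_lt_iff] at h
  -- The infimum need not be attained, but a strict inequality yields an admissible η below K, and
  -- the integrand decreases in the scale.
  obtain ⟨η, hη, hint, hlt⟩ := h
  have hηK : η < K := (ENNReal.ofReal_lt_ofReal_iff_of_nonneg hη.le).1 hlt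
  have hK : 0 < K := hη.trans hηK
  have hm : Measurable fun ω => psi α |Y ω / K| := by unfold psi; fun_prop
  have hn : ∀ ω, 0 ≤ psi α |Y ω / K| := fun ω => by
    unfold psi; rw [sub_nonneg, Real.one_le_exp_iff]; positivity
  have hle : ∫⁻ ω, ENNReal.ofReal (psi α |Y ω / K|) ∂P ≤ 1 := by
    refine (lintegral_mono fun ω => ENNReal.ofReal_le_ofReal ?_).trans hint
    unfold psi
    rw [abs_div, abs_of_pos hK]
    gcongr
  have hi : Integrable (fun ω => psi α |Y ω / K|) P := by
    refine ⟨hm.aestronglyMeasurable, ?_⟩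
    rw [hasFiniteIntegral_iff_ofReal (Filter.Eventually.of_forall hn)]
    exact hle.trans_lt ENNReal.one_lt_top
  have hI : ∫ ω, psi α |Y ω / K| ∂P ≤ 1 := by
    rw [← ofReal_integral_eq_lintegral_ofReal hi (Filter.Eventually.of_forall hn),
      ← ENNReal.ofReal_one] at hle
    exact (ENNReal.ofReal_le_ofReal_iff zero_le_one).1 hle
  have e : (fun ω => Real.exp (|Y ω / K| ^ α)) = fun ω => psi α |Y ω / K| + 1 := by
    ext ω; unfold psi; ring
  refine ⟨by rw [e]; exact hi.add (integrable_const 1), ?_⟩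
  rw [e, integral_add hi (integrable_const 1)]
  simp only [integral_const, probReal_univ, smul_eq_mul, mul_one]
  linarith

lemma integral_center {Y : Ω → ℝ} (h : Integrable Y P) :
    ∫ ω, (Y ω - ∫ ω', Y ω' ∂P) / 2 ∂P = 0 := by
  rw [integral_div, integral_sub h (integrable_const _)]
  simp

/-- Deviation of a sum from its mean. -/
lemma mean_deviation {n : ℕ} (hn : 1 ≤ n) {α K s : ℝ} (hα : 0 < α) (hα2 : α ≤ 2) (hK : 0 < K)
    (hs : 1 ≤ s) {Y : Fin n → Ω → ℝ} (hm : ∀ i, Measurable (Y i)) (hind : iIndepFun Y P)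
    (hY : ∀ i, ExpMoment P α 2 (fun ω => Y i ω / K)) :
    P.real {ω | 2 * K * (Real.sqrt n * (devConst α (shiftConst α 2) *
        (Real.log (2 * n) ^ (1 / α) * s ^ (1 / α)))) < |∑ i, (Y i ω - ∫ ω', Y i ω' ∂P)|} ≤
      3 * Real.exp (-s) := by
  have hmK : ∀ i, Measurable fun ω => Y i ω / K := fun i => (hm i).div_const K
  refine (measureReal_mono fun ω hω => ?_).trans
    (deviation_sqrt hn hα hα2 (W := fun i ω => (Y i ω / K - ∫ ω', Y i ω' / K ∂P) / 2)
    (fun i => ((hmK i).sub_const _).div_const _)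
    (hind.comp (fun i y => (y / K - ∫ ω', Y i ω' / K ∂P) / 2) fun i => by fun_prop)
    (fun i => (hY i).center (hmK i) hα) (fun i => integral_center ((hY i).integrable (hmK i) hα).1)
    hs)
  simp only [Set.mem_ofPred_eq] at hω ⊢
  have e : ∑ i, (Y i ω - ∫ ω', Y i ω' ∂P) =
      2 * K * ∑ i, (Y i ω / K - ∫ ω', Y i ω' / K ∂P) / 2 := by
    rw [Finset.mul_sum]
    refine Finset.sum_congr rfl fun i _ => ?_
    rw [integral_div]; field_simp
  rw [e, abs_mul, abs_of_pos (by positivity : 0 < 2 * K)] at hω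
  exact lt_of_mul_lt_mul_left hω (by positivity)

/-- Deviation of a sum of products from its mean. -/
lemma product_deviation {n : ℕ} (hn : 1 ≤ n) {α K s : ℝ} (hα : 0 < α) (hα2 : α ≤ 2) (hK : 0 < K)
    (hs : 1 ≤ s) {Y Z : Fin n → Ω → ℝ} (mY : ∀ i, Measurable (Y i)) (mZ : ∀ i, Measurable (Z i))
    (hind : iIndepFun (fun i ω => (Y i ω, Z i ω)) P)
    (hY : ∀ i, ExpMoment P α 2 (fun ω => Y i ω / K))
    (hZ : ∀ i, ExpMoment P α 2 (fun ω => Z i ω / K))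
    {a b : ℝ} (ha : |a / K| ≤ meanConst α 2) (hb : |b / K| ≤ meanConst α 2) :
    P.real {ω | 2 * Real.sqrt (s * ∑ i, variance (fun ω => (Y i ω - a) * (Z i ω - b)) P) +
        8 * K ^ 2 * (devConst (α / 2) (shiftConst (α / 2) (shiftConst α 2)) *
        (Real.log (2 * n) ^ (2 / α) * s ^ (2 / α))) <
        |∑ i, ((Y i ω - a) * (Z i ω - b) - ∫ ω', (Y i ω' - a) * (Z i ω' - b) ∂P)|} ≤
      3 * Real.exp (-s) := by
  set q : Fin n → Ω → ℝ := fun i ω => (Y i ω / K - a / K) / 2 * ((Z i ω / K - b / K) / 2) with hq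
  have mq : ∀ i, Measurable (q i) := fun i => by
    have := mY i; have := mZ i; fun_prop
  have hqE : ∀ i, ExpMoment P (α / 2) (shiftConst α 2) (q i) := fun i =>
    ((hY i).shift ((mY i).div_const K) hα ha).mul ((hZ i).shift ((mZ i).div_const K) hα hb)
      (by have := mY i; fun_prop) (by have := mZ i; fun_prop)
  have hα' : 0 < α / 2 := by positivity
  have eq1 : ∀ i ω, (Y i ω - a) * (Z i ω - b) = 4 * K ^ 2 * q i ω := fun i ω => by
    simp only [hq]; field_simp; ring
  -- The factor 8K² collects K² from rescaling, 4 from halving both factors, and 2 from halving the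
  -- centered product.
  have eq2 : ∀ i ω, (Y i ω - a) * (Z i ω - b) - ∫ ω', (Y i ω' - a) * (Z i ω' - b) ∂P =
      8 * K ^ 2 * ((q i ω - ∫ ω', q i ω' ∂P) / 2) := fun i ω => by
    simp only [eq1]; rw [integral_const_mul]; ring
  have eq3 : ∑ i, ∫ ω, ((q i ω - ∫ ω', q i ω' ∂P) / 2) ^ 2 ∂P =
      (∑ i, variance (fun ω => (Y i ω - a) * (Z i ω - b)) P) / (8 * K ^ 2) ^ 2 := by
    rw [Finset.sum_div]
    refine Finset.sum_congr rfl fun i _ => ?_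
    rw [variance_eq_integral
      (by have := mY i; have := mZ i; exact Measurable.aemeasurable (by fun_prop))]
    simp only [eq2, mul_pow _ (_ / _)]
    rw [integral_const_mul, mul_div_cancel_left₀ _ (by positivity)]
  have e12 : 1 / (α / 2) = 2 / α := by field_simp
  have main := deviation_variance hn hα' (by linarith)
    (W := fun i ω => (q i ω - ∫ ω', q i ω' ∂P) / 2)
    (fun i => ((mq i).sub_const _).div_const _)
    (hind.comp (fun i y => ((y.1 / K - a / K) / 2 * ((y.2 / K - b / K) / 2) -
      ∫ ω', q i ω' ∂P) / 2) fun i => by fun_prop)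
    (fun i => (hqE i).center (mq i) hα')
    (fun i => integral_center ((hqE i).integrable (mq i) hα').1) hs eq3.le
  refine (measureReal_mono fun ω hω => ?_).trans main
  simp only [Set.mem_ofPred_eq, eq2] at hω ⊢
  rw [← Finset.mul_sum, abs_mul, abs_of_pos (by positivity : 0 < 8 * K ^ 2)] at hω
  -- By homogeneity the rescaling cancels in the variance term, so K enters only the remainder.
  have hsq : Real.sqrt (s * ∑ i, variance (fun ω => (Y i ω - a) * (Z i ω - b)) P) =
      8 * K ^ 2 * Real.sqrt (s * ((∑ i, variance (fun ω => (Y i ω - a) * (Z i ω - b)) P) /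
        (8 * K ^ 2) ^ 2)) := by
    rw [← mul_div_assoc, Real.sqrt_div' _ (by positivity), Real.sqrt_sq (by positivity)]
    field_simp
  rw [hsq] at hω
  rw [e12]
  refine lt_of_mul_lt_mul_left (a := 8 * K ^ 2) ?_ (by positivity)
  linarith

/-- The constant of the covariance bound. -/
def covConst (α : ℝ) : ℝ :=
  8 * devConst (α / 2) (shiftConst (α / 2) (shiftConst α 2)) +
    4 * devConst α (shiftConst α 2) ^ 2

lemma covConst_pos {α : ℝ} (hα : 0 < α) : 0 < covConst α := by
  have h1 : 0 ≤ shiftConst α 2 := by unfold shiftConst; positivity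
  have h2 : 0 ≤ shiftConst (α / 2) (shiftConst α 2) := by
    generalize shiftConst α 2 = B at h1
    unfold shiftConst; positivity
  have := devConst_pos (half_pos hα) h2
  have := devConst_pos hα h1
  unfold covConst; positivity

end SubWeibull
end

/-! ### Union bound and passage to the exact scale -/

noncomputable section

namespace SubWeibull

variable {Ω : Type*} [MeasurableSpace Ω] {P : Measure Ω}

/-- The bound for `covError`, as a function of the scale `K` and of `s = t + 2 log p`. -/
def covBound (P : Measure Ω) (α : ℝ) {n p : ℕ} (X : Fin n → Ω → Fin p → ℝ) (s K : ℝ) : ℝ :=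
  7 * maxStdDev P X * Real.sqrt (s / n) +
    covConst α * K ^ 2 * Real.log (2 * n) ^ (2 / α) * s ^ (2 / α) / n

/-- The summands need not share a mean, so the products are shifted by the averaged mean, which
inherits the common bound on the individual means. -/
lemma abs_meanVec_div_le {n p : ℕ} (hn : 1 ≤ n) {α K : ℝ} (hα : 0 < α) (hK : 0 < K)
    {X : Fin n → Ω → Fin p → ℝ} (hX : ∀ i j, Measurable fun ω => X i ω j)
    (hE : ∀ i j, ExpMoment P α 2 (fun ω => X i ω j / K)) (j : Fin p) :
    (∀ i, Integrable (fun ω => X i ω j) P) ∧ |meanVec P X j / K| ≤ meanConst α 2 := by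
  have hi : ∀ i, Integrable (fun ω => X i ω j) P := fun i => by
    have := (((hE i j).integrable ((hX i j).div_const K) hα).1).mul_const K
    simpa [div_mul_cancel₀ _ hK.ne'] using this
  refine ⟨hi, ?_⟩
  have hn' : (n : ℝ) ≠ 0 := by positivity
  rw [meanVec_apply hi]
  have e : (n : ℝ)⁻¹ * (∑ i, ∫ ω, X i ω j ∂P) / K =
      (n : ℝ)⁻¹ * ∑ i, ∫ ω, X i ω j / K ∂P := by
    simp only [integral_div, ← Finset.sum_div]; ring
  rw [e, abs_mul, abs_of_nonneg (by positivity), inv_mul_le_iff₀ (by positivity)]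
  refine (Finset.abs_sum_le_sum_abs _ _).trans ?_
  refine (Finset.sum_le_sum fun i _ => ((hE i j).integrable ((hX i j).div_const K) hα).2).trans ?_
  simp [meanConst]

variable [IsProbabilityMeasure P]

/-- Deterministic combination of the bounds for the products and for the means. -/
lemma entry_bound {n : ℕ} (hn : 1 ≤ n) {S A V s K D₁ D₂ G u v : ℝ} {M : ℝ}
    (hs : 0 ≤ s) (hA : Real.sqrt ((n : ℝ)⁻¹ * V) ≤ A)
    (hS : |S| ≤ 2 * Real.sqrt (s * V) + 8 * K ^ 2 * (D₂ * G ^ 2))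
    (hu : |u| ≤ 2 * K * (Real.sqrt n * (D₁ * G))) (hv : |v| ≤ 2 * K * (Real.sqrt n * (D₁ * G)))
    (hM : M = (n : ℝ)⁻¹ * S - ((n : ℝ)⁻¹ * u) * ((n : ℝ)⁻¹ * v)) :
    |M| ≤ 7 * A * Real.sqrt (s / n) + (8 * D₂ + 4 * D₁ ^ 2) * K ^ 2 * G ^ 2 / n := by
  have hn' : (0 : ℝ) < n := by exact_mod_cast hn
  have h1 : (n : ℝ)⁻¹ * Real.sqrt (s * V) = Real.sqrt ((n : ℝ)⁻¹ * V) * Real.sqrt (s / n) := by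
    rw [mul_comm (Real.sqrt _) (Real.sqrt (s / n)), ← Real.sqrt_mul (by positivity)]
    rw [show s / n * ((n : ℝ)⁻¹ * V) = s * V / (n : ℝ) ^ 2 by field_simp,
      Real.sqrt_div' _ (by positivity), Real.sqrt_sq hn'.le]
    field_simp
  have h2 := mul_le_mul_of_nonneg_right hA (Real.sqrt_nonneg (s / n))
  have h3 : 0 ≤ A * Real.sqrt (s / n) :=
    mul_nonneg ((Real.sqrt_nonneg _).trans hA) (Real.sqrt_nonneg _)
  have h4 : |u * v| ≤ 4 * K ^ 2 * n * (D₁ ^ 2 * G ^ 2) := by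
    rw [abs_mul]
    refine (mul_le_mul hu hv (abs_nonneg _) ((abs_nonneg _).trans hu)).trans (le_of_eq ?_)
    have := Real.mul_self_sqrt hn'.le
    linear_combination (4 * K ^ 2 * D₁ ^ 2 * G ^ 2) * this
  have h5 := mul_le_mul_of_nonneg_left hS (inv_nonneg.2 hn'.le)
  have h6 := mul_le_mul_of_nonneg_left h4 (by positivity : 0 ≤ ((n : ℝ)⁻¹) ^ 2)
  have h7 : |M| ≤ (n : ℝ)⁻¹ * |S| + ((n : ℝ)⁻¹) ^ 2 * |u * v| := by
    rw [hM]
    refine (abs_sub _ _).trans (le_of_eq ?_)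
    rw [abs_mul, abs_of_nonneg (inv_nonneg.2 hn'.le),
      show (n : ℝ)⁻¹ * u * ((n : ℝ)⁻¹ * v) = ((n : ℝ)⁻¹) ^ 2 * (u * v) by ring, abs_mul (_ ^ 2),
      abs_of_nonneg (by positivity : 0 ≤ ((n : ℝ)⁻¹) ^ 2)]
  have h8 : ((n : ℝ)⁻¹) ^ 2 * (4 * K ^ 2 * n * (D₁ ^ 2 * G ^ 2)) =
      4 * D₁ ^ 2 * K ^ 2 * G ^ 2 / n := by field_simp
  have h9 : (8 * D₂ + 4 * D₁ ^ 2) * K ^ 2 * G ^ 2 / n =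
      (n : ℝ)⁻¹ * (8 * K ^ 2 * (D₂ * G ^ 2)) + 4 * D₁ ^ 2 * K ^ 2 * G ^ 2 / n := by
    field_simp
  rw [h9]
  -- Only 2A√(s/n) is needed; nonnegativity of A√(s/n) (`h3`) relaxes the 2 to 7.
  nlinarith

/-- Outside the p² product events and p mean events, each of probability at most 3e^{-s}, every
entry is controlled by `entry_bound`. -/
lemma covError_tail {n p : ℕ} (hn : 1 ≤ n) (hp : 1 ≤ p) {α K s : ℝ} (hα : 0 < α) (hα2 : α ≤ 2)
    (hK : 0 < K) (hs : 1 ≤ s) {X : Fin n → Ω → Fin p → ℝ} (hX : ∀ i, Measurable (X i))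
    (hind : iIndepFun X P) (hE : ∀ i j, ExpMoment P α 2 (fun ω => X i ω j / K)) :
    P.real {ω | covBound P α X s K < covError P X ω} ≤ 6 * ((p : ℝ) ^ 2 * Real.exp (-s)) := by
  have hXj : ∀ i j, Measurable fun ω => X i ω j := fun i j => (measurable_pi_apply j).comp (hX i)
  have hmean := abs_meanVec_div_le hn hα hK hXj hE
  have hn' : (0 : ℝ) < n := by exact_mod_cast hn
  have hp' : (1 : ℝ) ≤ p := by exact_mod_cast hp
  have hL : 0 ≤ Real.log (2 * n) := by linarith [one_le_two_mul_log hn]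
  have : Nonempty (Fin p) := ⟨⟨0, hp⟩⟩
  set E : Fin p × Fin p → Set Ω := fun jk => {ω |
    2 * Real.sqrt (s * ∑ i, variance (fun ω => (X i ω jk.1 - meanVec P X jk.1) *
        (X i ω jk.2 - meanVec P X jk.2)) P) +
      8 * K ^ 2 * (devConst (α / 2) (shiftConst (α / 2) (shiftConst α 2)) *
        (Real.log (2 * n) ^ (2 / α) * s ^ (2 / α))) <
      |∑ i, ((X i ω jk.1 - meanVec P X jk.1) * (X i ω jk.2 - meanVec P X jk.2) -
        ∫ ω', (X i ω' jk.1 - meanVec P X jk.1) * (X i ω' jk.2 - meanVec P X jk.2) ∂P)|} with hEdef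
  set F : Fin p → Set Ω := fun j => {ω | 2 * K * (Real.sqrt n * (devConst α (shiftConst α 2) *
      (Real.log (2 * n) ^ (1 / α) * s ^ (1 / α)))) <
      |∑ i, (X i ω j - ∫ ω', X i ω' j ∂P)|} with hFdef
  have hEle : ∀ jk, P.real (E jk) ≤ 3 * Real.exp (-s) := fun jk =>
    product_deviation hn hα hα2 hK hs (fun i => hXj i jk.1) (fun i => hXj i jk.2)
      (hind.comp (fun _ x => (x jk.1, x jk.2)) fun _ => by fun_prop)
      (fun i => hE i jk.1) (fun i => hE i jk.2) (hmean jk.1).2 (hmean jk.2).2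
  have hFle : ∀ j, P.real (F j) ≤ 3 * Real.exp (-s) := fun j =>
    mean_deviation hn hα hα2 hK hs (fun i => hXj i j)
      (hind.comp (fun _ x => x j) fun _ => by fun_prop) (fun i => hE i j)
  have hsub : {ω | covBound P α X s K < covError P X ω} ⊆ (⋃ jk, E jk) ∪ ⋃ j, F j := by
    intro ω hω
    by_contra hc
    simp only [Set.mem_union, Set.mem_iUnion, not_or, not_exists, hEdef, hFdef,
      Set.mem_ofPred_eq, not_lt] at hc hω
    obtain ⟨⟨j, k⟩, hjk⟩ := exists_lt_of_lt_ciSup hω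
    refine hjk.not_ge ?_
    have hG : Real.log (2 * n) ^ (2 / α) * s ^ (2 / α) =
        (Real.log (2 * n) ^ (1 / α) * s ^ (1 / α)) ^ 2 := by
      rw [← Real.mul_rpow hL (by linarith), ← Real.mul_rpow hL (by linarith), ← Real.rpow_natCast,
        ← Real.rpow_mul (mul_nonneg hL (by linarith))]
      congr 1; push_cast; ring
    have hmj : ∀ j, sampleMean X ω j - meanVec P X j =
        (n : ℝ)⁻¹ * ∑ i, (X i ω j - ∫ ω', X i ω' j ∂P) := fun j => by
      rw [sampleMean_apply, meanVec_apply (hmean j).1, Finset.sum_sub_distrib]; ring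
    have h1 := hc.1 (j, k)
    have hM := sampleCov_sub_popCov_apply (P := P) hn X ω j k
    rw [hmj, hmj] at hM
    rw [hG] at h1
    have := entry_bound hn (by linarith) (le_maxStdDev X j k) h1 (hc.2 j) (hc.2 k) hM
    rw [covBound, mul_assoc (_ * K ^ 2), hG]
    exact this
  have h1 := (measureReal_mono hsub).trans (measureReal_union_le (μ := P) _ _)
  have h2 := (measureReal_iUnion_fintype_le (μ := P) E).trans (Finset.sum_le_sum fun jk _ => hEle jk)
  have h3 := (measureReal_iUnion_fintype_le (μ := P) F).trans (Finset.sum_le_sum fun j _ => hFle j)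
  simp only [Finset.sum_const, Finset.card_univ, Fintype.card_prod, Fintype.card_fin,
    nsmul_eq_mul, Nat.cast_mul] at h2 h3
  have h4 := Real.exp_pos (-s)
  -- Here 3p² + 3p ≤ 6p².
  nlinarith [mul_le_mul_of_nonneg_right hp' (by positivity : 0 ≤ (p : ℝ) * Real.exp (-s))]

/-- Lower semicontinuity: a tail bound for every larger scale gives it for the scale itself. -/
lemma covError_tail_of_forall_gt {n p : ℕ} {α K s c : ℝ} {X : Fin n → Ω → Fin p → ℝ}
    (hα : 0 < α) (hn : 1 ≤ n) (hs : 0 ≤ s) (hK : 0 ≤ K)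
    (h : ∀ K', K < K' → P.real {ω | covBound P α X s K' < covError P X ω} ≤ c) :
    P.real {ω | covBound P α X s K < covError P X ω} ≤ c := by
  have hL : 0 ≤ Real.log (2 * n) := by linarith [one_le_two_mul_log hn]
  have hC := (covConst_pos hα).le
  set f : ℕ → ℝ := fun m => covBound P α X s (K + 1 / (m + 1)) with hf
  have hanti : Antitone f := by
    intro m m' hm
    have : 1 / ((m' : ℝ) + 1) ≤ 1 / ((m : ℝ) + 1) := Nat.one_div_le_one_div hm
    have h0 : 0 ≤ 1 / ((m' : ℝ) + 1) := by positivity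
    simp only [hf, covBound]
    gcongr
  have hlim : Filter.Tendsto f Filter.atTop (nhds (covBound P α X s K)) := by
    have hc : Continuous fun x => covBound P α X s x := by unfold covBound; fun_prop
    have := (tendsto_one_div_add_atTop_nhds_zero_nat (𝕜 := ℝ)).const_add K
    rw [add_zero] at this
    exact (hc.tendsto K).comp this
  -- The strict inequality in the event makes it an increasing union over scales decreasing to K, so
  -- continuity from below applies.
  have hU : {ω | covBound P α X s K < covError P X ω} = ⋃ m, {ω | f m < covError P X ω} := by
    ext ω
    simp only [Set.mem_ofPred_eq, Set.mem_iUnion]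
    exact ⟨fun hω => (hlim.eventually_lt_const hω).exists,
      fun ⟨m, hm⟩ => (hanti.le_of_tendsto hlim m).trans_lt hm⟩
  have hc : 0 ≤ c := measureReal_nonneg.trans (h (K + 1) (by linarith))
  have hmono : Monotone fun m => {ω | f m < covError P X ω} :=
    fun m m' hm ω (hω : f m < _) => (hanti hm).trans_lt hω
  rw [hU, measureReal_def, hmono.measure_iUnion]
  refine ENNReal.toReal_le_of_le_ofReal hc (iSup_le fun m => ?_)
  rw [← ofReal_measureReal]
  exact ENNReal.ofReal_le_ofReal (h _ (lt_add_of_pos_right _ (by positivity)))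

end SubWeibull
end

theorem mainTheorem11 (α : ℝ) (hα : 0 < α) (hα2 : α ≤ 2) :
    ∃ C : ℝ, 0 < C ∧
      ∀ (n p : ℕ), 1 ≤ n → 1 ≤ p →
      ∀ (Ω : Type*) [MeasurableSpace Ω] (P : Measure Ω) [IsProbabilityMeasure P]
        (X : Fin n → Ω → Fin p → ℝ) (K : ℝ≥0),
        (∀ i, Measurable (X i)) →
        iIndepFun X P →
        (⨆ i, SubWeibull.marginalNorm P α (X i)) ≤ (K : ℝ≥0∞) →
        ∀ t : ℝ, 0 ≤ t →
          1 - 6 * Real.exp (-t) ≤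
            P.real {ω | SubWeibull.covError P X ω ≤
              7 * SubWeibull.maxStdDev P X * Real.sqrt ((t + 2 * Real.log p) / n) +
              C * (K : ℝ) ^ 2 * (Real.log (2 * n)) ^ (2 / α) *
                (t + 2 * Real.log p) ^ (2 / α) / n} := by
  refine ⟨SubWeibull.covConst α, SubWeibull.covConst_pos hα, ?_⟩
  intro n p hn hp Ω _ P _ X K hX hind hK t ht
  -- For t < 1 the claimed probability is negative, since 6/e > 1. The remaining case provides s ≥
  -- 1.
  rcases lt_or_ge t 1 with ht1 | ht1
  · have h1 := Real.add_one_le_exp (-t)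
    have h2 : (1 : ℝ) / 6 ≤ Real.exp (-t) := by
      have h3 : Real.exp (-1) ≤ Real.exp (-t) := Real.exp_le_exp.2 (by linarith)
      linarith [Real.exp_neg_one_gt_d9]
    exact le_trans (by linarith) measureReal_nonneg
  have hp' : (1 : ℝ) ≤ p := by exact_mod_cast hp
  set s := t + 2 * Real.log p with hsdef
  have hs : 1 ≤ s := by linarith [Real.log_nonneg hp']
  have hes : (p : ℝ) ^ 2 * Real.exp (-s) = Real.exp (-t) := by
    have : Real.exp (-s) = Real.exp (-t) * ((p : ℝ) ^ 2)⁻¹ := by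
      rw [hsdef, neg_add, Real.exp_add, Real.exp_neg (2 * _), two_mul, Real.exp_add,
        Real.exp_log (by linarith), ← sq]
    rw [this]; field_simp
  -- Every scale K' > K is positive and strictly above the norms, so K = 0 and an unattained infimum
  -- need no separate treatment.
  have htail := SubWeibull.covError_tail_of_forall_gt (P := P) (X := X) (α := α) (s := s) hα hn
    (by linarith) K.2 fun K' hK' =>
      SubWeibull.covError_tail hn hp hα hα2 (K.2.trans_lt hK') hs hX hind fun i j => by
        refine SubWeibull.ExpMoment.of_orliczNorm_lt hα
          ((measurable_pi_apply j).comp (hX i)) ?_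
        refine lt_of_le_of_lt (((le_iSup (fun j => SubWeibull.orliczNorm P (SubWeibull.psi α)
          fun ω => X i ω j) j).trans
          (le_iSup (fun i => SubWeibull.marginalNorm P α (X i)) i)).trans hK) ?_
        rw [← ENNReal.ofReal_coe_nnreal]
        exact (ENNReal.ofReal_lt_ofReal_iff_of_nonneg K.2).2 hK'
  rw [hes] at htail
  have hcover := measureReal_union_le (μ := P)
    {ω | SubWeibull.covError P X ω ≤ SubWeibull.covBound P α X s K}
    {ω | SubWeibull.covError P X ω ≤ SubWeibull.covBound P α X s K}ᶜ
  rw [Set.union_compl_self] at hcover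
  have hcompl : {ω | SubWeibull.covError P X ω ≤ SubWeibull.covBound P α X s K}ᶜ =
      {ω | SubWeibull.covBound P α X s K < SubWeibull.covError P X ω} := by
    ext ω; simp
  rw [hcompl, probReal_univ] at hcover
  have := hcover.trans (add_le_add le_rfl htail)
  unfold SubWeibull.covBound at this
  linarith
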